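/- Let $K$ be a field, $V$ a finite-dimensional $K$-vector space and $f:V\to V$ a nilpotent $K$-linear map. A subspace $X\subseteq V$ is called hyperinvariant (under $f$) if $gX\subseteq X$ for every endomorphism $g$ of $V$ commuting with $f$, and characteristic (with respect to $f$) if $fX\subseteq X$ and $gX\subseteq X$ for every automorphism $g$ of $V$ commuting with $f$. For a characteristic subspace $X$ let $X_H$ denote the largest hyperinvariant subspace contained in $X$. For $t\ge 1$ let $$d(f,t)=\dim\bigl((\operatorname{Ker} f\cap f^{t-1}V)\,/\,(\operatorname{Ker} f\cap f^{t}V)\bigr),$$ which is the number of elementary divisors of $f$ equal to $\lambda^t$. Let $E$ and $G$ be $f$-invariant subspaces of $V$ such that $V=E\oplus G$ and, for all $t\ge1$, $d(f,t)=d(f_{|E},t)$ if $d(f,t)=1$, and $d(f,t)=d(f_{|G},t)$ if $d(f,t)>1$. Let $\pi_E$ be the projection of $V$ onto $E$ along $G$, and $\pi_G$ the projection onto $G$ along $E$. Suppose $X$ is a characteristic subspace of $V$. (i) Then $\pi_E X=X\cap E$, $\pi_G X=X\cap G$, and $X=(X\cap E)\oplus(X\cap G)$. Moreover, $X\cap E$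 is characteristic in $E$ with respect to $f_{|E}$, $X\cap G$ is hyperinvariant in $G$ under $f_{|G}$, and $$X_H=(X\cap E)_{H|E}\oplus(X\cap G),$$ where $(X\cap E)_{H|E}$ is the largest subspace contained in $X\cap E$ that is hyperinvariant in $E$ under $f_{|E}$. (ii) The subspace $X$ is hyperinvariant in $V$ if and only if $X\cap E$ is hyperinvariant in $E$ under $f_{|E}$. -/

import Mathlib

namespace NilpotentInvariant

variable {K V : Type*} [Field K] [AddCommGroup V] [Module K V]

/-- The Ulm invariant
`d(f, r) = dim ((Ker f ∩ f ^ (r - 1) V) / (Ker f ∩ f ^ r V))`, for `r ≥ 1`.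
For nilpotent `f` it is the number of elementary divisors of `f` equal to `λ ^ r`. -/
noncomputable def ulmInvariant (f : Module.End K V) (r : ℕ) : ℕ :=
  Module.finrank K
    (↥(LinearMap.ker f ⊓ LinearMap.range (f ^ (r - 1))) ⧸
      (LinearMap.ker f ⊓ LinearMap.range (f ^ r)).submoduleOf
        (LinearMap.ker f ⊓ LinearMap.range (f ^ (r - 1))))

/-- `X` is hyperinvariant under `f`: it is mapped into itself by every endomorphism that
commutes with `f`. -/
def IsHyperinvariant (f : Module.End K V) (X : Submodule K V) : Prop :=
  ∀ g : Module.End K V, Commute g f → ∀ x ∈ X, g x ∈ X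

/-- `X` is characteristic with respect to `f`: it is `f`-invariant and it is mapped into itself
by every automorphism that commutes with `f`. -/
def IsCharacteristic (f : Module.End K V) (X : Submodule K V) : Prop :=
  (∀ x ∈ X, f x ∈ X) ∧
    ∀ g : V ≃ₗ[K] V, Commute (g : Module.End K V) f → ∀ x ∈ X, g x ∈ X

/-- `X_H`, the largest hyperinvariant subspace contained in `X`
(see `isGreatest_hyperinvariantCore`). -/
noncomputable def hyperinvariantCore (f : Module.End K V) (X : Submodule K V) : Submodule K V :=
  sSup {W : Submodule K V | IsHyperinvariant f W ∧ W ≤ X}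

theorem isGreatest_hyperinvariantCore (f : Module.End K V) (X : Submodule K V) :
    IsGreatest {W : Submodule K V | IsHyperinvariant f W ∧ W ≤ X} (hyperinvariantCore f X) := by
  refine ⟨⟨fun g hg => ?_, sSup_le fun W hW => hW.2⟩, fun W hW => le_sSup hW⟩
  change hyperinvariantCore f X ≤ (hyperinvariantCore f X).comap g
  refine sSup_le fun W hW x hx => ?_
  exact (le_sSup hW : W ≤ hyperinvariantCore f X) (hW.1 g hg x hx)

end NilpotentInvariant

/-! If `n` commutes with `f` and `n * n = 0`, then `1 + n` is an automorphism commuting with `f`, so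
a characteristic subspace is stable under `n`, hence under the non-unital ring generated by all such
`n`. The hypotheses force `d(f|G, t) ≠ 1` for every `t ≥ 1`. So in a decomposition of `G` into
cyclic `K[X]`-modules each nonzero summand has an isomorphic partner, and this makes every
endomorphism of `G` commuting with `f|G` a sum of products of square-zero ones
(`mem_closure_commute_sq_zero_of_ulmInvariant_ne_one`).

Extension by zero from `G` to `V` preserves sums, products and square-zero maps, so `X` is stable
under all these extensions (`IsCharacteristic.extendByZero_apply_mem`). The identity of `G` extends
to `π_G`, which splits `X`; the other extensions make `X ∩ G` hyperinvariant. The formula for `X_H`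
follows blockwise, since off-diagonal blocks of a commuting map are square-zero. -/

namespace NilpotentInvariant

open Polynomial

/-! ### Endomorphisms generated by square-zero ones -/

section SquareZero

/-- Write `a` as the sum of the blocks `p i * a * (1 - p i)`, which square to zero, and `p i * a * p
i`. A diagonal block factors through the partner summand as `σ * (τ * a * p i)`, both factors being
square-zero. The closure is non-unital, so that the identity itself must be generated. -/
theorem mem_closure_sq_zero_of_pi {R ι : Type*} [Ring R] [Fintype ι] [DecidableEq ι]
    {N : ι → Type*} [∀ i, AddCommGroup (N i)] [∀ i, Module R (N i)]
    (h : ∀ i, Subsingleton (N i) ∨ ∃ j, j ≠ i ∧ Nonempty (N i ≃ₗ[R] N j))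
    (a : Module.End R (∀ i, N i)) :
    a ∈ NonUnitalSubring.closure {n : Module.End R (∀ i, N i) | n * n = 0} := by
  set S := NonUnitalSubring.closure {n : Module.End R (∀ i, N i) | n * n = 0} with hS
  have hmem : ∀ n : Module.End R (∀ i, N i), n * n = 0 → n ∈ S := fun n hn =>
    NonUnitalSubring.subset_closure hn
  let p : ι → Module.End R (∀ i, N i) := fun i => LinearMap.single R N i ∘ₗ LinearMap.proj i
  have hpp : ∀ i, p i * p i = p i := fun i => by
    ext x j
    simp [p]
  have hsum : ∑ i, p i = 1 := by
    refine LinearMap.ext fun x => ?_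
    simp [p, LinearMap.sum_apply, Finset.univ_sum_single]
  have hblock : ∀ i, p i * a * p i ∈ S := by
    intro i
    rcases h i with hi | ⟨j, hj, ⟨e⟩⟩
    · have : p i = 0 := by
        refine LinearMap.ext fun x => ?_
        have : x i = 0 := Subsingleton.elim _ _
        simp [p, this]
      simp [this, S.zero_mem]
    · let τ : Module.End R (∀ i, N i) :=
        LinearMap.single R N j ∘ₗ e.toLinearMap ∘ₗ LinearMap.proj i
      let σ : Module.End R (∀ i, N i) :=
        LinearMap.single R N i ∘ₗ e.symm.toLinearMap ∘ₗ LinearMap.proj j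
      have hστ : σ * τ = p i := LinearMap.ext fun x => by simp [σ, τ, p]
      have hσ : σ * σ = 0 := LinearMap.ext fun x => by simp [σ, hj]
      have hpτ : p i * τ = 0 := LinearMap.ext fun x => by simp [τ, p, hj.symm]
      have hτ : (τ * a * p i) * (τ * a * p i) = 0 := by
        have : (τ * a * p i) * (τ * a * p i) = τ * a * (p i * τ) * a * p i := by
          simp only [mul_assoc]
        rw [this, hpτ]; simp
      have := S.mul_mem (hmem _ hσ) (hmem _ hτ)
      rwa [← mul_assoc, ← mul_assoc, hστ] at this
  have hoff : ∀ i, p i * a * (1 - p i) ∈ S := by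
    intro i
    refine hmem _ ?_
    have : (p i * a * (1 - p i)) * (p i * a * (1 - p i)) =
        p i * a * ((1 - p i) * p i) * a * (1 - p i) := by simp only [mul_assoc]
    rw [this, sub_mul, one_mul, hpp, sub_self]; simp
  have ha : a = ∑ i, (p i * a * (1 - p i) + p i * a * p i) := by
    conv_lhs => rw [← one_mul a, ← hsum, Finset.sum_mul]
    refine Finset.sum_congr rfl fun i _ => ?_
    rw [← mul_add, sub_add_cancel, mul_one]
  rw [ha]
  exact S.sum_mem fun i _ => S.add_mem (hoff i) (hblock i)

/-- Maps commuting with `f` are the `K[X]`-linear maps of `Module.AEval' f`, so the module statement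
transports along `e`. -/
theorem mem_closure_commute_sq_zero {K V : Type*} [Field K] [AddCommGroup V] [Module K V]
    (f : Module.End K V) {ι : Type*} [Fintype ι] [DecidableEq ι]
    {N : ι → Type*} [∀ i, AddCommGroup (N i)] [∀ i, Module K[X] (N i)]
    (e : Module.AEval' f ≃ₗ[K[X]] ∀ i, N i)
    (h : ∀ i, Subsingleton (N i) ∨ ∃ j, j ≠ i ∧ Nonempty (N i ≃ₗ[K[X]] N j))
    (a : Module.End K V) (ha : Commute a f) :
    a ∈ NonUnitalSubring.closure {n : Module.End K V | Commute n f ∧ n * n = 0} := by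
  let o := Module.AEval'.of f
  let down : Module.End K[X] (∀ i, N i) →ₙ+* Module.End K V :=
    { toFun := fun b => o.symm.toLinearMap ∘ₗ
        ((e.symm.toLinearMap ∘ₗ b ∘ₗ e.toLinearMap).restrictScalars K) ∘ₗ o.toLinearMap
      map_mul' := fun b c => LinearMap.ext fun x => by simp
      map_zero' := LinearMap.ext fun x => by simp
      map_add' := fun b c => LinearMap.ext fun x => by simp }
  have hdown : ∀ b x, down b x = o.symm (e.symm (b (e (o x)))) := fun _ _ => rfl
  have hcomm : ∀ b, Commute (down b) f := fun b => LinearMap.ext fun x => by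
    have : o (f x) = (X : K[X]) • o x := (Module.AEval'.X_smul_of f x).symm
    simp only [Module.End.mul_apply, hdown, this, map_smul]
    exact Module.AEval'.of_symm_X_smul f _
  let a' : Module.End K[X] (Module.AEval' f) :=
    LinearMap.ofAEval f (o.toLinearMap ∘ₗ a) fun m => by
      change o (a (f m)) = (X : K[X]) • o (a m)
      rw [show (X : K[X]) • o (a m) = o (f (a m)) from Module.AEval'.X_smul_of f (a m)]
      exact congrArg o (LinearMap.congr_fun ha m)
  have hb : a = down (e.toLinearMap ∘ₗ a' ∘ₗ e.symm.toLinearMap) := LinearMap.ext fun x => by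
    rw [hdown]
    simp [a', LinearMap.ofAEval, o]
  rw [hb]
  have := (NonUnitalSubring.mem_map (f := down)).2
    ⟨_, mem_closure_sq_zero_of_pi h (e.toLinearMap ∘ₗ a' ∘ₗ e.symm.toLinearMap), rfl⟩
  have hle : (NonUnitalSubring.closure {n : Module.End K[X] (∀ i, N i) | n * n = 0}).map down ≤
      NonUnitalSubring.closure {n : Module.End K V | Commute n f ∧ n * n = 0} := by
    rw [NonUnitalSubring.map_le_iff_le_comap, NonUnitalSubring.closure_le]
    intro n hn
    refine NonUnitalSubring.subset_closure ⟨hcomm n, ?_⟩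
    rw [← map_mul, show n * n = 0 from hn, map_zero]
  exact hle this

end SquareZero

/-! ### Ulm invariants and direct sums -/

section Ulm

variable {K V : Type*} [Field K] [AddCommGroup V] [Module K V]

theorem ulmInvariant_add_finrank [FiniteDimensional K V] (f : Module.End K V) (t : ℕ) :
    ulmInvariant f t + Module.finrank K ↥(LinearMap.ker f ⊓ LinearMap.range (f ^ t)) =
      Module.finrank K ↥(LinearMap.ker f ⊓ LinearMap.range (f ^ (t - 1))) := by
  have hle : LinearMap.ker f ⊓ LinearMap.range (f ^ t) ≤
      LinearMap.ker f ⊓ LinearMap.range (f ^ (t - 1)) := by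
    refine inf_le_inf_left _ ?_
    rintro _ ⟨x, rfl⟩
    refine ⟨(f ^ (t - (t - 1))) x, ?_⟩
    rw [← Module.End.mul_apply, ← pow_add]
    congr 2
    omega
  rw [← (Submodule.submoduleOfEquivOfLe hle).finrank_eq, ulmInvariant,
    Submodule.finrank_quotient_add_finrank]

theorem coe_restrict_pow_apply (f : Module.End K V) {E : Submodule K V} (hE : ∀ x ∈ E, f x ∈ E)
    (n : ℕ) (x : E) : (((LinearMap.restrict f hE) ^ n) x : V) = (f ^ n) x := by
  induction n with
  | zero => simp
  | succ n ih => simp [pow_succ', ih]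

theorem map_subtype_ker_inf_range_le (f : Module.End K V) {E : Submodule K V}
    (hE : ∀ x ∈ E, f x ∈ E) (n : ℕ) :
    (LinearMap.ker (LinearMap.restrict f hE) ⊓
      LinearMap.range ((LinearMap.restrict f hE) ^ n)).map E.subtype ≤
      LinearMap.ker f ⊓ LinearMap.range (f ^ n) := by
  rintro _ ⟨x, ⟨hx, y, rfl⟩, rfl⟩
  refine ⟨?_, y, ?_⟩
  · simpa using congrArg Subtype.val (LinearMap.mem_ker.1 hx)
  · simp [coe_restrict_pow_apply]

theorem finrank_ker_inf_range_pow [FiniteDimensional K V] (f : Module.End K V)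
    {E G : Submodule K V} (hE : ∀ x ∈ E, f x ∈ E) (hG : ∀ x ∈ G, f x ∈ G) (hEG : IsCompl E G)
    (n : ℕ) :
    Module.finrank K ↥(LinearMap.ker f ⊓ LinearMap.range (f ^ n)) =
      Module.finrank K ↥(LinearMap.ker (LinearMap.restrict f hE) ⊓
        LinearMap.range ((LinearMap.restrict f hE) ^ n)) +
      Module.finrank K ↥(LinearMap.ker (LinearMap.restrict f hG) ⊓
        LinearMap.range ((LinearMap.restrict f hG) ^ n)) := by
  set A := LinearMap.ker (LinearMap.restrict f hE) ⊓
        LinearMap.range ((LinearMap.restrict f hE) ^ n) with hA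
  set B := LinearMap.ker (LinearMap.restrict f hG) ⊓
        LinearMap.range ((LinearMap.restrict f hG) ^ n) with hB
  have hsup : LinearMap.ker f ⊓ LinearMap.range (f ^ n) = A.map E.subtype ⊔ B.map G.subtype := by
    refine le_antisymm ?_ (sup_le (map_subtype_ker_inf_range_le f hE n)
      (map_subtype_ker_inf_range_le f hG n))
    rintro _ ⟨hx, z, rfl⟩
    obtain ⟨u, hu, v, hv, rfl⟩ : ∃ u ∈ E, ∃ v ∈ G, u + v = z :=
      Submodule.mem_sup.1 (hEG.sup_eq_top ▸ Submodule.mem_top)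
    have hu' := coe_restrict_pow_apply f hE n ⟨u, hu⟩
    have hv' := coe_restrict_pow_apply f hG n ⟨v, hv⟩
    set u' := ((LinearMap.restrict f hE) ^ n) ⟨u, hu⟩
    set v' := ((LinearMap.restrict f hG) ^ n) ⟨v, hv⟩
    have h0 : f u' + f v' = 0 := by
      rw [hu', hv', ← map_add, ← map_add]; exact hx
    have hfu : f u' = 0 := by
      refine Submodule.disjoint_def.1 hEG.disjoint _ (hE _ u'.2) ?_
      rw [eq_neg_of_add_eq_zero_left h0]
      exact G.neg_mem (hG _ v'.2)
    have hfv : f v' = 0 := by rwa [hfu, zero_add] at h0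
    rw [map_add]
    refine Submodule.add_mem_sup ⟨u', ⟨?_, ⟨u, hu⟩, rfl⟩, hu'⟩ ⟨v', ⟨?_, ⟨v, hv⟩, rfl⟩, hv'⟩
    · exact LinearMap.mem_ker.2 (Subtype.ext hfu)
    · exact LinearMap.mem_ker.2 (Subtype.ext hfv)
  have hdis : Disjoint (A.map E.subtype) (B.map G.subtype) :=
    hEG.disjoint.mono (Submodule.map_subtype_le E A) (Submodule.map_subtype_le G B)
  have := Submodule.finrank_sup_add_finrank_inf_eq (A.map E.subtype) (B.map G.subtype)
  rw [hdis.eq_bot, finrank_bot, add_zero, Submodule.finrank_map_subtype_eq,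
    Submodule.finrank_map_subtype_eq] at this
  rw [hsup, this]

theorem ulmInvariant_eq_add [FiniteDimensional K V] (f : Module.End K V)
    {E G : Submodule K V} (hE : ∀ x ∈ E, f x ∈ E) (hG : ∀ x ∈ G, f x ∈ G) (hEG : IsCompl E G)
    (t : ℕ) :
    ulmInvariant f t = ulmInvariant (LinearMap.restrict f hE) t +
      ulmInvariant (LinearMap.restrict f hG) t := by
  have h1 := ulmInvariant_add_finrank f t
  have h2 := ulmInvariant_add_finrank (LinearMap.restrict f hE) t
  have h3 := ulmInvariant_add_finrank (LinearMap.restrict f hG) t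
  have h4 := finrank_ker_inf_range_pow f hE hG hEG t
  have h5 := finrank_ker_inf_range_pow f hE hG hEG (t - 1)
  omega

theorem ulmInvariant_eq_one (f : Module.End K V) (t : ℕ) (v : V) (hv : f v = 0)
    (hvr : v ∈ LinearMap.range (f ^ (t - 1))) (hvn : v ∉ LinearMap.range (f ^ t))
    (h : ∀ w, f w = 0 → w ∈ LinearMap.range (f ^ (t - 1)) →
      ∃ c : K, w - c • v ∈ LinearMap.range (f ^ t)) :
    ulmInvariant f t = 1 := by
  refine finrank_eq_one (Submodule.Quotient.mk ⟨v, hv, hvr⟩) ?_ ?_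
  · intro h0
    rw [Submodule.Quotient.mk_eq_zero] at h0
    exact hvn h0.2
  · intro w
    obtain ⟨⟨w, hw, hwr⟩, rfl⟩ := Submodule.Quotient.mk_surjective _ w
    obtain ⟨c, hc⟩ := h w hw hwr
    refine ⟨c, ?_⟩
    rw [← Submodule.Quotient.mk_smul, eq_comm, Submodule.Quotient.eq]
    refine ⟨?_, hc⟩
    have hw : f w = 0 := hw
    simp [hw, hv]

end Ulm

/-! ### Ulm invariants of sums of cyclic modules -/

section Cyclic

variable {K : Type*} [Field K]

/-- A cyclic summand of length `k ≠ t` contributes nothing to the invariant at `t`. -/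
theorem exists_eq_X_pow_smul_of_ne {k t : ℕ} (ht : 1 ≤ t) (hk : k ≠ t)
    (z : K[X] ⧸ K[X] ∙ (X ^ k : K[X])) (hz : (X : K[X]) • (X ^ (t - 1) : K[X]) • z = 0) :
    ∃ u : K[X] ⧸ K[X] ∙ (X ^ k : K[X]), (X ^ (t - 1) : K[X]) • z = (X ^ t : K[X]) • u := by
  obtain ⟨p, rfl⟩ := Submodule.Quotient.mk_surjective _ z
  rw [smul_smul, ← pow_succ', Nat.sub_add_cancel ht, ← Submodule.Quotient.mk_smul,
    Submodule.Quotient.mk_eq_zero, Submodule.mem_span_singleton] at hz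
  obtain ⟨q, hq⟩ := hz
  simp only [smul_eq_mul] at hq
  -- For `k < t`, `X ^ (t - 1)` kills the module. For `k > t`, `X ^ t • z = 0` forces `z` to be a
  -- multiple of `X ^ (k - t)`.
  rcases lt_or_gt_of_ne hk with hlt | hgt
  · refine ⟨0, ?_⟩
    rw [smul_zero, ← Submodule.Quotient.mk_smul, Submodule.Quotient.mk_eq_zero,
      Submodule.mem_span_singleton]
    refine ⟨X ^ (t - 1 - k) * p, ?_⟩
    rw [smul_eq_mul, smul_eq_mul, mul_right_comm, ← pow_add]
    congr 2
    omega
  · refine ⟨Submodule.Quotient.mk (X ^ (k - 1 - t) * q), ?_⟩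
    have hp : p = X ^ (k - t) * q := by
      refine mul_left_cancel₀ (pow_ne_zero t (X_ne_zero (R := K))) ?_
      rw [← hq, ← mul_assoc, ← pow_add, mul_comm q]
      congr 2
      omega
    rw [← Submodule.Quotient.mk_smul, ← Submodule.Quotient.mk_smul]
    congr 1
    rw [hp, smul_eq_mul, smul_eq_mul, ← mul_assoc, ← mul_assoc, ← pow_add, ← pow_add]
    congr 2
    omega

/-- Modulo `X ^ t`, only the constant coefficient of a representative survives multiplication by `X
^ (t - 1)`. -/
theorem exists_X_pow_smul_eq_C_smul {t : ℕ} (ht : 1 ≤ t)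
    (z : K[X] ⧸ K[X] ∙ (X ^ t : K[X])) :
    ∃ c : K, (X ^ (t - 1) : K[X]) • z =
      C c • (Submodule.Quotient.mk (X ^ (t - 1)) : K[X] ⧸ K[X] ∙ (X ^ t : K[X])) := by
  obtain ⟨p, rfl⟩ := Submodule.Quotient.mk_surjective _ z
  refine ⟨p.coeff 0, ?_⟩
  rw [← Submodule.Quotient.mk_smul, ← Submodule.Quotient.mk_smul, Submodule.Quotient.eq,
    Submodule.mem_span_singleton]
  refine ⟨p.divX, ?_⟩
  conv_rhs => rw [← p.divX_mul_X_add]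
  obtain ⟨s, rfl⟩ := Nat.exists_eq_add_of_le' ht
  simp only [smul_eq_mul, Nat.add_sub_cancel, coeff_add, coeff_C_zero, mul_coeff_zero,
    coeff_X_zero, mul_zero, zero_add]
  ring

theorem X_pow_pred_ne {t : ℕ} (ht : 1 ≤ t) (u : K[X] ⧸ K[X] ∙ (X ^ t : K[X])) :
    (Submodule.Quotient.mk (X ^ (t - 1)) : K[X] ⧸ K[X] ∙ (X ^ t : K[X])) ≠
      (X ^ t : K[X]) • u := by
  obtain ⟨p, rfl⟩ := Submodule.Quotient.mk_surjective _ u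
  intro h
  rw [← Submodule.Quotient.mk_smul, Submodule.Quotient.eq, Submodule.mem_span_singleton] at h
  obtain ⟨q, hq⟩ := h
  have hdvd : (X ^ t : K[X]) ∣ X ^ (t - 1) :=
    ⟨q + p, by simp only [smul_eq_mul] at hq; linear_combination -hq⟩
  have := (pow_dvd_pow_iff (X_ne_zero (R := K)) not_isUnit_X).1 hdvd
  omega

theorem ulmInvariant_eq_one_of_unique {V : Type*} [AddCommGroup V] [Module K V]
    (f : Module.End K V) {ι : Type*} [DecidableEq ι] (k : ι → ℕ)
    (e : Module.AEval' f ≃ₗ[K[X]] ∀ i, K[X] ⧸ K[X] ∙ (X ^ k i : K[X])) (i : ι) (hi : 1 ≤ k i)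
    (huniq : ∀ j, j ≠ i → k j ≠ k i) :
    ulmInvariant f (k i) = 1 := by
  let g : V → ∀ i, K[X] ⧸ K[X] ∙ (X ^ k i : K[X]) := fun x => e (Module.AEval'.of f x)
  have hinj : Function.Injective g := e.injective.comp (Module.AEval'.of f).injective
  have hsurj : Function.Surjective g := e.surjective.comp (Module.AEval'.of f).surjective
  have hpow : ∀ n x, g ((f ^ n) x) = (X ^ n : K[X]) • g x := fun n x => by
    simp only [g]
    rw [← map_smul]
    exact congrArg e (Module.AEval.X_pow_smul_of f x n).symm
  have hone : ∀ x, g (f x) = (X : K[X]) • g x := fun x => by simpa using hpow 1 x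
  have hsub : ∀ x y, g (x - y) = g x - g y := fun x y => by simp [g]
  have hC : ∀ (c : K) x, g (c • x) = C c • g x := fun c x => by
    simp only [g]
    rw [map_smul, ← map_smul e, Module.AEval.C_smul]
  have hzero : g 0 = 0 := by simp [g]
  have hrange : ∀ n x, x ∈ LinearMap.range (f ^ n) ↔ ∃ y, g x = (X ^ n : K[X]) • y := by
    refine fun n x => ⟨?_, ?_⟩
    · rintro ⟨y, rfl⟩
      exact ⟨g y, hpow n y⟩
    · rintro ⟨y, hy⟩
      obtain ⟨y, rfl⟩ := hsurj y
      exact ⟨y, hinj ((hpow n y).trans hy.symm)⟩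
  obtain ⟨v, hv⟩ := hsurj (Pi.single i (Submodule.Quotient.mk (X ^ (k i - 1))))
  refine ulmInvariant_eq_one f (k i) v ?_ ?_ ?_ ?_
  · refine hinj ?_
    rw [hone, hv, hzero, ← Pi.single_smul, ← Submodule.Quotient.mk_smul, smul_eq_mul,
      ← pow_succ', Nat.sub_add_cancel hi,
      (Submodule.Quotient.mk_eq_zero _).2 (Submodule.mem_span_singleton_self _), Pi.single_zero]
  · refine (hrange _ _).2 ⟨Pi.single i (Submodule.Quotient.mk 1), ?_⟩
    rw [hv, ← Pi.single_smul, ← Submodule.Quotient.mk_smul, smul_eq_mul, mul_one]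
  · rw [hrange]
    rintro ⟨y, hy⟩
    refine X_pow_pred_ne hi (y i) ?_
    simpa [hv] using congrFun hy i
  · intro w hw hwr
    obtain ⟨y, hy⟩ := (hrange _ _).1 hwr
    obtain ⟨c, hc⟩ := exists_X_pow_smul_eq_C_smul hi (y i)
    refine ⟨c, (hrange _ _).2 ?_⟩
    have hw0 : (X : K[X]) • (X ^ (k i - 1) : K[X]) • y = 0 := by
      rw [← hy, ← hone, hw, hzero]
    have key : ∀ j, ∃ u, g (w - c • v) j = (X ^ k i : K[X]) • u := by
      intro j
      rw [hsub, hC, hv, hy]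
      by_cases hj : j = i
      · subst hj
        exact ⟨0, by simp [hc]⟩
      · obtain ⟨u, hu⟩ := exists_eq_X_pow_smul_of_ne hi (huniq j hj) (y j) (congrFun hw0 j)
        exact ⟨u, by simpa [hj] using hu⟩
    choose u hu using key
    exact ⟨u, funext hu⟩

theorem mem_closure_commute_sq_zero_of_ulmInvariant_ne_one {V : Type*} [AddCommGroup V]
    [Module K V] [FiniteDimensional K V] (f : Module.End K V) (hf : IsNilpotent f)
    (h : ∀ t, 1 ≤ t → ulmInvariant f t ≠ 1) (a : Module.End K V) (ha : Commute a f) :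
    a ∈ NonUnitalSubring.closure {n : Module.End K V | Commute n f ∧ n * n = 0} := by
  have htors : Module.IsTorsion' (Module.AEval' f) (Submonoid.powers (X : K[X])) := by
    rw [Submodule.isTorsion'_powers_iff]
    intro x
    obtain ⟨n, hn⟩ := hf
    refine ⟨n, (Module.AEval'.of f).symm.injective ?_⟩
    obtain ⟨x, rfl⟩ := (Module.AEval'.of f).surjective x
    rw [show (X ^ n : K[X]) • Module.AEval'.of f x = Module.AEval'.of f ((f ^ n) x) from
      Module.AEval.X_pow_smul_of f x n, hn]
    simp
  obtain ⟨d, k, ⟨e⟩⟩ := Module.torsion_by_prime_power_decomposition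
    (irreducible_X (R := K)) htors
  let e' := e.trans (DirectSum.linearEquivFunOnFintype K[X] (Fin d)
    fun i => K[X] ⧸ K[X] ∙ (X ^ k i : K[X]))
  refine mem_closure_commute_sq_zero f e' (fun i => ?_) a ha
  -- The decomposition may contain zero summands, with exponent `0`; these need no partner.
  rcases Nat.eq_zero_or_pos (k i) with hi | hi
  · left
    rw [hi, pow_zero]
    exact Submodule.Quotient.subsingleton_iff.2 Ideal.span_singleton_one
  · right
    by_contra hcon
    refine h (k i) hi (ulmInvariant_eq_one_of_unique f k e' i hi fun j hj hkj => hcon ⟨j, hj, ?_⟩)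
    rw [hkj]
    exact ⟨LinearEquiv.refl _ _⟩

end Cyclic

end NilpotentInvariant

namespace NilpotentInvariant

/-! ### Characteristic subspaces and the blocks of `V = E ⊕ G` -/

section Decomposition

variable {K V : Type*} [Field K] [AddCommGroup V] [Module K V] {f : Module.End K V}

/-- The automorphism `1 + n` has inverse `1 - n`, and `n x = (1 + n) x - x`. -/
theorem IsCharacteristic.apply_mem_of_sq_zero {X : Submodule K V} (hX : IsCharacteristic f X)
    {n : Module.End K V} (hn : Commute n f) (hn0 : n * n = 0) {x : V} (hx : x ∈ X) :
    n x ∈ X := by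
  let g : V ≃ₗ[K] V := LinearEquiv.ofLinearMap (1 + n) (1 - n)
    (by change (1 + n) * (1 - n) = 1; simp [mul_sub, add_mul, hn0])
    (by change (1 - n) * (1 + n) = 1; simp [mul_add, sub_mul, hn0])
  have hg : (g : Module.End K V) = 1 + n := rfl
  have := hX.2 g (hg ▸ (Commute.one_left f).add_left hn) x hx
  have hgx : g x = x + n x := rfl
  rw [hgx] at this
  simpa using X.sub_mem this hx

variable {E G : Submodule K V} (hE : ∀ x ∈ E, f x ∈ E) (hG : ∀ x ∈ G, f x ∈ G)
  (hEG : IsCompl E G)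

include hE hG in
theorem projectionOnto_apply_comm (x : V) :
    E.projectionOnto G hEG (f x) = LinearMap.restrict f hE (E.projectionOnto G hEG x) := by
  have hx := Submodule.projection_add_projection_eq_self hEG x
  have hq := hG _ (Submodule.projection_apply_mem hEG.symm x)
  conv_lhs => rw [← hx, map_add, map_add, (Submodule.projectionOnto_apply_eq_zero_iff hEG).2 hq,
    add_zero]
  rw [Submodule.projectionOnto_apply_of_mem_left hEG
    (hE _ (Submodule.projection_apply_mem hEG x))]
  rfl

include hE hG in
theorem commute_projection : Commute (E.projection G hEG) f := LinearMap.ext fun x =>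
  congrArg Subtype.val (projectionOnto_apply_comm hE hG hEG x)

/-- The endomorphism of `V = E ⊕ G` that is `a` on `E` and zero on `G`. -/
noncomputable def extendByZero (hEG : IsCompl E G) (a : Module.End K E) : Module.End K V :=
  E.subtype ∘ₗ a ∘ₗ E.projectionOnto G hEG

/-- The compression to `E` of an endomorphism of `V = E ⊕ G`. -/
noncomputable def compression (hEG : IsCompl E G) (g : Module.End K V) : Module.End K E :=
  E.projectionOnto G hEG ∘ₗ g ∘ₗ E.subtype

theorem extendByZero_apply (a : Module.End K E) (x : V) :
    extendByZero hEG a x = a (E.projectionOnto G hEG x) := rfl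

theorem extendByZero_apply_coe (a : Module.End K E) (x : E) :
    extendByZero hEG a x = a x := by
  rw [extendByZero_apply, Submodule.projectionOnto_apply_left]

include hG in
theorem commute_extendByZero {a : Module.End K E} (ha : Commute a (LinearMap.restrict f hE)) :
    Commute (extendByZero hEG a) f := LinearMap.ext fun x => by
  simp only [Module.End.mul_apply, extendByZero_apply, projectionOnto_apply_comm hE hG hEG]
  exact congrArg Subtype.val (LinearMap.congr_fun ha _)

include hG in
theorem commute_compression {g : Module.End K V} (hg : Commute g f) :
    Commute (compression hEG g) (LinearMap.restrict f hE) := LinearMap.ext fun x => by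
  have h : g (f x) = f (g x) := LinearMap.congr_fun hg x
  have := projectionOnto_apply_comm hE hG hEG (g x)
  rw [← h] at this
  exact this

include hG in
/-- An off-diagonal block of a commuting endomorphism preserves characteristic subspaces. -/
theorem IsCharacteristic.projection_apply_mem {X : Submodule K V} (hX : IsCharacteristic f X)
    (hE : ∀ x ∈ E, f x ∈ E) (hEG : IsCompl E G)
    {g : Module.End K V} (hg : Commute g f) {y : V} (hyX : y ∈ X) (hyG : y ∈ G) :
    E.projection G hEG (g y) ∈ X := by
  have hp := commute_projection hE hG hEG
  have hq := commute_projection hG hE hEG.symm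
  have hqp : G.projection E hEG.symm * E.projection G hEG = 0 := LinearMap.ext fun x =>
    (Submodule.projection_apply_eq_zero_iff hEG.symm).2 (Submodule.projection_apply_mem hEG x)
  have := hX.apply_mem_of_sq_zero
    (n := E.projection G hEG * g * G.projection E hEG.symm) ((hp.mul_left hg).mul_left hq)
    (by
      have : E.projection G hEG * g * G.projection E hEG.symm *
          (E.projection G hEG * g * G.projection E hEG.symm) =
          E.projection G hEG * g * (G.projection E hEG.symm * E.projection G hEG) * g *
          G.projection E hEG.symm := by simp only [mul_assoc]
      rw [this, hqp]; simp) hyX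
  simpa only [Module.End.mul_apply,
    Submodule.projection_apply_of_mem_left hEG.symm hyG] using this

include hE in
theorem IsCharacteristic.extendByZero_apply_mem {X : Submodule K V} (hX : IsCharacteristic f X)
    (hG : ∀ x ∈ G, f x ∈ G) (hEG : IsCompl E G) {a : Module.End K E}
    (ha : a ∈ NonUnitalSubring.closure
      {n : Module.End K E | Commute n (LinearMap.restrict f hE) ∧ n * n = 0})
    {x : V} (hx : x ∈ X) : extendByZero hEG a x ∈ X := by
  induction ha using NonUnitalSubring.closure_induction generalizing x with
  | mem n hn =>
    refine hX.apply_mem_of_sq_zero (commute_extendByZero hE hG hEG hn.1)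
      (LinearMap.ext fun y => ?_) hx
    rw [Module.End.mul_apply, extendByZero_apply hEG n y, extendByZero_apply_coe]
    exact congrArg Subtype.val (LinearMap.congr_fun hn.2 _)
  | zero => exact X.zero_mem
  | add a b _ _ iha ihb => exact X.add_mem (iha hx) (ihb hx)
  | neg a _ iha => exact X.neg_mem (iha hx)
  | mul a b _ _ iha ihb =>
    have := iha (ihb hx)
    rwa [extendByZero_apply hEG b, extendByZero_apply_coe] at this

theorem IsHyperinvariant.submoduleOf {X : Submodule K V} (hX : IsHyperinvariant f X)
    (hE : ∀ x ∈ E, f x ∈ E) (hG : ∀ x ∈ G, f x ∈ G) (hEG : IsCompl E G) :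
    IsHyperinvariant (LinearMap.restrict f hE) (X.submoduleOf E) := fun a ha x hx => by
  have := hX _ (commute_extendByZero hE hG hEG ha) x hx
  rwa [extendByZero_apply_coe] at this

theorem IsCharacteristic.submoduleOf {X : Submodule K V} (hX : IsCharacteristic f X)
    (hE : ∀ x ∈ E, f x ∈ E) (hG : ∀ x ∈ G, f x ∈ G) (hEG : IsCompl E G) :
    IsCharacteristic (LinearMap.restrict f hE) (X.submoduleOf E) := by
  refine ⟨fun x hx => hX.1 x hx, fun g hg x hx => ?_⟩
  -- An automorphism of `E` is extended by the identity on `G`.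
  let φ := Submodule.prodEquivOfIsCompl E G hEG
  let g' : V ≃ₗ[K] V := φ.symm ≪≫ₗ (g.prodCongr (LinearEquiv.refl K G)) ≪≫ₗ φ
  have hg' : (g' : Module.End K V) =
      extendByZero hEG (g : Module.End K E) + G.projection E hEG.symm := LinearMap.ext fun y => by
    obtain ⟨⟨u, v⟩, rfl⟩ := φ.surjective y
    simp [g', φ, extendByZero_apply]
  have hcomm : Commute (g' : Module.End K V) f := hg' ▸
    (commute_extendByZero hE hG hEG hg).add_left (commute_projection hG hE hEG.symm)
  have := hX.2 g' hcomm x hx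
  have hgx : g' x = g x := by
    refine (LinearMap.congr_fun hg' x).trans ?_
    rw [LinearMap.add_apply, extendByZero_apply_coe, Submodule.projection_apply_right, add_zero]
    rfl
  rwa [hgx] at this

/-- Commuting images in `E` of vectors of a characteristic subspace lying in `G` belong to the
hyperinvariant core of the intersection with `E`. -/
theorem IsCharacteristic.compression_mem_hyperinvariantCore {X : Submodule K V}
    (hX : IsCharacteristic f X) (hE : ∀ x ∈ E, f x ∈ E) (hG : ∀ x ∈ G, f x ∈ G)
    (hEG : IsCompl E G) {g : Module.End K V} (hg : Commute g f) {y : V} (hyX : y ∈ X)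
    (hyG : y ∈ G) :
    E.projectionOnto G hEG (g y) ∈
      hyperinvariantCore (LinearMap.restrict f hE) (X.submoduleOf E) := by
  -- The span of all such images is hyperinvariant, as following `h` by an extended `a` is again a
  -- commuting map; it lies in `X` because the blocks from `G` to `E` are square-zero.
  let T : Submodule K E := Submodule.span K
    {z | ∃ h : Module.End K V, Commute h f ∧ ∃ y ∈ X, y ∈ G ∧ z = E.projectionOnto G hEG (h y)}
  have hT : IsHyperinvariant (LinearMap.restrict f hE) T := by
    intro a ha
    change T ≤ T.comap a
    refine Submodule.span_le.2 ?_
    rintro _ ⟨h, hh, y, hyX, hyG, rfl⟩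
    refine Submodule.subset_span ⟨extendByZero hEG a * h,
      (commute_extendByZero hE hG hEG ha).mul_left hh, y, hyX, hyG, ?_⟩
    rw [Module.End.mul_apply, extendByZero_apply, Submodule.projectionOnto_apply_left]
  have hTX : T ≤ X.submoduleOf E := by
    refine Submodule.span_le.2 ?_
    rintro _ ⟨h, hh, y, hyX, hyG, rfl⟩
    exact hX.projection_apply_mem hG hE hEG hh hyX hyG
  exact (isGreatest_hyperinvariantCore _ _).2 ⟨hT, hTX⟩
    (Submodule.subset_span ⟨g, hg, y, hyX, hyG, rfl⟩)

/-- Each of the four blocks of a commuting `g` is checked separately; the one from `G` to `E` must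
land in the core, not merely in `X`. -/
theorem IsCharacteristic.isHyperinvariant_core_sup {X : Submodule K V}
    (hX : IsCharacteristic f X) (hE : ∀ x ∈ E, f x ∈ E) (hG : ∀ x ∈ G, f x ∈ G)
    (hEG : IsCompl E G)
    (hXG : IsHyperinvariant (LinearMap.restrict f hG) (X.submoduleOf G)) :
    IsHyperinvariant f ((hyperinvariantCore (LinearMap.restrict f hE)
      (X.submoduleOf E)).map E.subtype ⊔ (X ⊓ G)) := by
  obtain ⟨⟨hcore, hcoreX⟩, -⟩ := isGreatest_hyperinvariantCore (LinearMap.restrict f hE)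
    (X.submoduleOf E)
  intro g hg z hz
  obtain ⟨_, ⟨w, hw, rfl⟩, y, ⟨hyX, hyG⟩, rfl⟩ := Submodule.mem_sup.1 hz
  rw [map_add]
  refine Submodule.add_mem _ ?_ ?_
  · rw [← Submodule.projection_add_projection_eq_self hEG (g _)]
    refine Submodule.add_mem_sup ⟨_, hcore _ (commute_compression hE hG hEG hg) w hw, rfl⟩
      ⟨?_, Submodule.projection_apply_mem hEG.symm _⟩
    exact hX.projection_apply_mem hE hG hEG.symm hg (hcoreX hw) w.2
  · rw [← Submodule.projection_add_projection_eq_self hEG (g y)]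
    refine Submodule.add_mem_sup
      ⟨_, hX.compression_mem_hyperinvariantCore hE hG hEG hg hyX hyG, rfl⟩
      ⟨?_, Submodule.projection_apply_mem hEG.symm _⟩
    exact hXG _ (commute_compression hG hE hEG.symm hg) ⟨y, hyG⟩ hyX

theorem map_projection_eq_inf {X : Submodule K V} (hEG : IsCompl E G)
    (h : ∀ x ∈ X, E.projection G hEG x ∈ X) : X.map (E.projection G hEG) = X ⊓ E := by
  refine le_antisymm ?_ ?_
  · rintro _ ⟨x, hx, rfl⟩
    exact ⟨h x hx, Submodule.projection_apply_mem hEG x⟩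
  · rintro x ⟨hx, hxE⟩
    exact ⟨x, hx, Submodule.projection_apply_of_mem_left hEG hxE⟩

theorem eq_inf_sup_inf {X : Submodule K V} (hEG : IsCompl E G)
    (hp : ∀ x ∈ X, E.projection G hEG x ∈ X) (hq : ∀ x ∈ X, G.projection E hEG.symm x ∈ X) :
    X = (X ⊓ E) ⊔ (X ⊓ G) := by
  refine le_antisymm (fun x hx => ?_) (sup_le inf_le_left inf_le_left)
  rw [← Submodule.projection_add_projection_eq_self hEG x]
  exact Submodule.add_mem_sup ⟨hp x hx, Submodule.projection_apply_mem hEG x⟩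
    ⟨hq x hx, Submodule.projection_apply_mem hEG.symm x⟩

end Decomposition

end NilpotentInvariant

/-! ### The main theorem -/

theorem mainTheorem6 {K V : Type*} [Field K] [AddCommGroup V] [Module K V]
    [FiniteDimensional K V] (f : Module.End K V) (hf : IsNilpotent f)
    (E G : Submodule K V) (hE : ∀ x ∈ E, f x ∈ E) (hG : ∀ x ∈ G, f x ∈ G)
    (hEG : IsCompl E G)
    (hdE : ∀ t : ℕ, 1 ≤ t → NilpotentInvariant.ulmInvariant f t = 1 →
      NilpotentInvariant.ulmInvariant f t =
        NilpotentInvariant.ulmInvariant (LinearMap.restrict f hE) t)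
    (hdG : ∀ t : ℕ, 1 ≤ t → 1 < NilpotentInvariant.ulmInvariant f t →
      NilpotentInvariant.ulmInvariant f t =
        NilpotentInvariant.ulmInvariant (LinearMap.restrict f hG) t)
    (X : Submodule K V) (hX : NilpotentInvariant.IsCharacteristic f X) :
    X.map (Submodule.projection E G hEG) = X ⊓ E ∧
    X.map (Submodule.projection G E hEG.symm) = X ⊓ G ∧
    (Disjoint (X ⊓ E) (X ⊓ G) ∧ X = (X ⊓ E) ⊔ (X ⊓ G)) ∧
    NilpotentInvariant.IsCharacteristic (LinearMap.restrict f hE) (X.submoduleOf E) ∧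
    NilpotentInvariant.IsHyperinvariant (LinearMap.restrict f hG) (X.submoduleOf G) ∧
    (Disjoint
        ((NilpotentInvariant.hyperinvariantCore (LinearMap.restrict f hE)
          (X.submoduleOf E)).map E.subtype) (X ⊓ G) ∧
      NilpotentInvariant.hyperinvariantCore f X =
        (NilpotentInvariant.hyperinvariantCore (LinearMap.restrict f hE)
          (X.submoduleOf E)).map E.subtype ⊔ (X ⊓ G)) ∧
    (NilpotentInvariant.IsHyperinvariant f X ↔
      NilpotentInvariant.IsHyperinvariant (LinearMap.restrict f hE) (X.submoduleOf E)) := by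

  -- The invariants of `E` and `G` add up to that of `f`. Were the `G` part `1`, a total of `1`
  -- would make the `E` part `1` as well, and a total above `1` would have to equal the `G` part.
  have hGne : ∀ t, 1 ≤ t → NilpotentInvariant.ulmInvariant (LinearMap.restrict f hG) t ≠ 1 := by
    intro t ht h1
    have hadd := NilpotentInvariant.ulmInvariant_eq_add f hE hG hEG t
    have h2 := hdE t ht
    have h3 := hdG t ht
    omega
  have hfG : IsNilpotent (LinearMap.restrict f hG) := by
    obtain ⟨n, hn⟩ := hf
    refine ⟨n, LinearMap.ext fun x => Subtype.ext ?_⟩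
    rw [NilpotentInvariant.coe_restrict_pow_apply, hn]
    rfl
  have hext : ∀ a : Module.End K G, Commute a (LinearMap.restrict f hG) → ∀ x ∈ X,
      NilpotentInvariant.extendByZero hEG.symm a x ∈ X := fun a ha x hx =>
    hX.extendByZero_apply_mem hG hE hEG.symm
      (NilpotentInvariant.mem_closure_commute_sq_zero_of_ulmInvariant_ne_one _ hfG hGne a ha) hx
  -- The identity of `G`, extended by zero, is `π_G`.
  have hq : ∀ x ∈ X, G.projection E hEG.symm x ∈ X := hext 1 (Commute.one_left _)
  have hp : ∀ x ∈ X, E.projection G hEG x ∈ X := fun x hx => by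
    rw [Submodule.projection_eq_self_sub_projection hEG.symm]
    exact X.sub_mem hx (hq x hx)
  have hXG : NilpotentInvariant.IsHyperinvariant (LinearMap.restrict f hG)
      (X.submoduleOf G) := fun a ha x hx => by
    have := hext a ha x hx
    rwa [NilpotentInvariant.extendByZero_apply_coe] at this
  have hsplit := NilpotentInvariant.eq_inf_sup_inf hEG hp hq
  obtain ⟨⟨hcore, hcoreX⟩, hcoreU⟩ := NilpotentInvariant.isGreatest_hyperinvariantCore
    (LinearMap.restrict f hE) (X.submoduleOf E)
  obtain ⟨⟨hV, hVX⟩, hVU⟩ := NilpotentInvariant.isGreatest_hyperinvariantCore f X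
  have heq : NilpotentInvariant.hyperinvariantCore f X =
        (NilpotentInvariant.hyperinvariantCore (LinearMap.restrict f hE)
          (X.submoduleOf E)).map E.subtype ⊔ (X ⊓ G) := by
    refine le_antisymm (fun x hx => ?_)
      (hVU ⟨hX.isHyperinvariant_core_sup hE hG hEG hXG, sup_le ?_ inf_le_left⟩)
    · rw [← Submodule.projection_add_projection_eq_self hEG x]
      refine Submodule.add_mem_sup ⟨E.projectionOnto G hEG x, hcoreU
          ⟨hV.submoduleOf hE hG hEG, fun y hy => hVX hy⟩
          (hV _ (NilpotentInvariant.commute_projection hE hG hEG) x hx), rfl⟩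
        ⟨hq x (hVX hx), Submodule.projection_apply_mem hEG.symm x⟩
    · rintro _ ⟨y, hy, rfl⟩
      exact hcoreX hy
  refine ⟨NilpotentInvariant.map_projection_eq_inf hEG hp,
    NilpotentInvariant.map_projection_eq_inf hEG.symm hq,
    ⟨hEG.disjoint.mono inf_le_right inf_le_right, hsplit⟩, hX.submoduleOf hE hG hEG, hXG,
    ⟨hEG.disjoint.mono (Submodule.map_subtype_le _ _) inf_le_right, heq⟩,
    fun h => h.submoduleOf hE hG hEG, fun h => ?_⟩
  -- A hyperinvariant `X ∩ E` is its own core, so the formula for `X_H` returns all of `X`.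
  have hle : X ≤ NilpotentInvariant.hyperinvariantCore f X := by
    rw [heq]
    conv_lhs => rw [hsplit]
    refine sup_le_sup_right ?_ _
    rintro x ⟨hx, hxE⟩
    exact ⟨⟨x, hxE⟩, hcoreU ⟨h, le_rfl⟩ hx, rfl⟩
  exact le_antisymm hVX hle ▸ hV
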